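/- Let $n\ge 1$ and $\lambda>0$. Let $\mathbb A^{(\lambda)}(\mathbb D^n)$ be the Hilbert space of holomorphic functions on the open unit polydisc $\mathbb D^n\subset\mathbb C^n$ with reproducing kernel $K^{(\lambda)}(\boldsymbol z,\boldsymbol w)=\prod_{j=1}^n(1-z_j\bar w_j)^{-\lambda}$; it is a Hilbert module over the ring $\mathbb C[\boldsymbol z]^{\mathfrak S_n}$ of symmetric polynomials under pointwise multiplication. The symmetric group $\mathfrak S_n$ acts by $\sigma\cdot\boldsymbol z=(z_{\sigma^{-1}(1)},\dots,z_{\sigma^{-1}(n)})$, and we put $$\mathbb P_{(n)}f=\frac1{n!}\sum_{\sigma\in\mathfrak S_n}f\circ\sigma^{-1},\qquad \mathbb P_{(1,\dots,1)}f=\frac1{n!}\sum_{\sigma\in\mathfrak S_n}\mathrm{sgn}(\sigma)\,f\circ\sigma^{-1},\qquad f\in\mathbb A^{(\lambda)}(\mathbb D^n).$$ The ranges of these operators (the symmetric, respectively antisymmetric, functions in $\mathbb A^{(\lambda)}(\mathbb D^n)$) are submodules over $\mathbb C[\boldsymbol z]^{\mathfrak S_n}$. Let $\boldsymbol s=(s_1,\dots,s_n):\mathbb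 C^n\to\mathbb C^n$ be the map given by the elementary symmetric polynomials and let $\mathbb G_n=\boldsymbol s(\mathbb D^n)$ be the symmetrized polydisc. Since $\mathbb C[\boldsymbol z]^{\mathfrak S_n}=\mathbb C[s_1,\dots,s_n]$, a Hilbert module over $\mathbb C[\boldsymbol z]^{\mathfrak S_n}$ is a Hilbert module over the polynomial ring in $n$ variables, in which $p\in\mathbb C[u_1,\dots,u_n]$ acts as $p(s_1,\dots,s_n)$. For a Hilbert module $\mathcal H$ over $\mathbb C[u_1,\dots,u_n]$ and $\boldsymbol u\in\mathbb C^n$, the module tensor product $\mathcal H\otimes\mathbb C_{\boldsymbol u}$ is identified with the orthogonal complement in $\mathcal H$ of $\{(p-p(\boldsymbol u))\cdot f: p\in\mathbb C[u_1,\dots,u_n],\ f\in\mathcal H\}$. For $\Omega\subseteq\mathbb C^n$ put $\Omega^*=\{\boldsymbol z:\bar{\boldsymbol z}\in\Omega\}$. The module $\mathcal H$ is locally free of rank $k$ on $\Omega$ if every $\boldsymbol w\in\Omega^*$ has an open neighbourhood $\Omega_0^*\subseteq\Omega^*$ with holomorphic maps $\gamma_1,\dots,\gamma_k:\Omega_0^*\to\mathcal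 H$ such that, for every $\boldsymbol z\in\Omega_0^*$, the vectors $\gamma_1(\boldsymbol z),\dots,\gamma_k(\boldsymbol z)$ form a basis of $\mathcal H\otimes\mathbb C_{\bar{\boldsymbol z}}$. Then the Hilbert modules $\mathbb P_{(n)}\big(\mathbb A^{(\lambda)}(\mathbb D^n)\big)$ and $\mathbb P_{(1,\dots,1)}\big(\mathbb A^{(\lambda)}(\mathbb D^n)\big)$ are both locally free of rank $1$ on all of $\mathbb G_n$. -/

import Mathlib

noncomputable section

namespace SymPolydisc

open scoped ComplexConjugate InnerProductSpace

/-! ### Scalar kernels given by a feature map -/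

section Feature

variable {X L : Type*} [NormedAddCommGroup L] [InnerProductSpace ℂ L]

/-- A scalar kernel, regarded as a matrix of operators on `ℂ`. -/
def kernelMatrix (k : X → X → ℂ) : Matrix X X (ℂ →L[ℂ] ℂ) :=
  fun x y => k x y • ContinuousLinearMap.id ℂ ℂ

open scoped ComplexOrder in
theorem posSemidef_of_feature (k : X → X → ℂ) (φ : X → L) (h : ∀ x y, ⟪φ x, φ y⟫_ℂ = k x y) :
    (kernelMatrix k).PosSemidef := by
  have key := (RKHS.posSemidef_tfae (K := kernelMatrix k)).out 0 2
  refine key.mpr ⟨?_, fun vv => ?_⟩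
  · ext x y
    simp only [Matrix.conjTranspose_apply, kernelMatrix, star_smul]
    rw [← h x y, ← h y x]
    simp [ContinuousLinearMap.star_eq_adjoint, ContinuousLinearMap.adjoint_id]
  · have : (vv.sum fun x w ↦ vv.sum fun x' w' ↦ ⟪kernelMatrix k x' x w, w'⟫_ℂ)
        = ⟪vv.sum fun x w => w • φ x, vv.sum fun x w => w • φ x⟫_ℂ := by
      simp only [Finsupp.sum, sum_inner, inner_sum]
      rw [Finset.sum_comm]
      refine Finset.sum_congr rfl fun x _ => Finset.sum_congr rfl fun y _ => ?_
      simp only [inner_smul_left, inner_smul_right, kernelMatrix, ← h]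
      simp [-mul_eq_mul_left_iff, -mul_eq_mul_right_iff]
      ring
    rw [this]
    exact inner_self_nonneg

variable {H : Type*} [NormedAddCommGroup H] [InnerProductSpace ℂ H] [CompleteSpace H]
  [RKHS ℂ H X ℂ] [CompleteSpace L]

theorem inner_kerFun_one (x : X) (f : H) : ⟪RKHS.kerFun H x (1 : ℂ), f⟫_ℂ = f x := by
  simp

theorem exists_isometry (φ : X → L)
    (h : ∀ x y, ⟪φ x, φ y⟫_ℂ = ⟪RKHS.kerFun H x (1 : ℂ), RKHS.kerFun H y (1 : ℂ)⟫_ℂ) :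
    ∃ S : H →ₗᵢ[ℂ] L, ∀ x, S (RKHS.kerFun H x (1 : ℂ)) = φ x := by
  let e : (X →₀ ℂ) →ₗ[ℂ] H := Finsupp.linearCombination ℂ fun x => RKHS.kerFun H x (1 : ℂ)
  let g : (X →₀ ℂ) →ₗ[ℂ] L := Finsupp.linearCombination ℂ φ
  have hn : ∀ c, ‖g c‖ = ‖e c‖ := by
    intro c
    have : ⟪g c, g c⟫_ℂ = ⟪e c, e c⟫_ℂ := by
      simp only [g, e, Finsupp.linearCombination_apply, Finsupp.sum, sum_inner, inner_sum,
        inner_smul_left, inner_smul_right, h]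
    rw [@norm_eq_sqrt_re_inner ℂ, this, ← @norm_eq_sqrt_re_inner ℂ]
  have hd : DenseRange e := by
    have h1 := RKHS.kerFun_dense (𝕜 := ℂ) H
    have h2 : Submodule.span ℂ {x : H | ∃ (y : X) (v : ℂ), RKHS.kerFun H y v = x}
        ≤ LinearMap.range e := by
      rw [Submodule.span_le]
      rintro _ ⟨y, v, rfl⟩
      refine ⟨Finsupp.single y v, ?_⟩
      simp only [e, Finsupp.linearCombination_single, ← map_smul, smul_eq_mul, mul_one]
    have h3 : (LinearMap.range e).topologicalClosure = ⊤ :=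
      top_le_iff.mp (h1 ▸ Submodule.topologicalClosure_mono h2)
    have := (Submodule.dense_iff_topologicalClosure_eq_top).mpr h3
    rwa [LinearMap.coe_range] at this
  have hb : ∃ C, ∀ c, ‖g c‖ ≤ C * ‖e c‖ := ⟨1, fun c => by rw [hn, one_mul]⟩
  refine ⟨⟨(g.extendOfNorm e : H →L[ℂ] L).toLinearMap, fun f => ?_⟩, fun x => ?_⟩
  · refine hd.induction_on (p := fun f => ‖(g.extendOfNorm e) f‖ = ‖f‖) f
      (isClosed_eq (by fun_prop) (by fun_prop)) fun c => ?_
    rw [LinearMap.extendOfNorm_eq hd hb, hn]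
  · have := LinearMap.extendOfNorm_eq hd hb (Finsupp.single x 1)
    simpa [e, g] using this

end Feature

/-! ### The expansion of the kernel -/

/-- The Taylor coefficients `(lam)_k / k!` of `(1 - x) ^ (-lam)`. -/
def coeff (lam : ℝ) (k : ℕ) : ℝ := (ascPochhammer ℝ k).eval lam / k.factorial

theorem coeff_pos {lam : ℝ} (hl : 0 < lam) (k : ℕ) : 0 < coeff lam k :=
  div_pos (ascPochhammer_pos k lam hl) (by positivity)

theorem coeff_succ (lam : ℝ) (k : ℕ) : coeff lam (k + 1) * (k + 1) = coeff lam k * (lam + k) := by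
  simp only [coeff, ascPochhammer_succ_eval, Nat.factorial_succ, Nat.cast_mul, Nat.cast_succ]
  field_simp

theorem hasSum_coeff (lam : ℝ) {x : ℂ} (hx : ‖x‖ < 1) :
    HasSum (fun k => (coeff lam k : ℂ) * x ^ k) ((1 - x) ^ (-(lam : ℂ))) := by
  have h := Complex.one_div_one_sub_cpow_hasFPowerSeriesOnBall_zero (lam : ℂ)
  have h2 := h.hasSum (y := x) (by simpa [enorm_eq_nnnorm, ← NNReal.coe_lt_coe] using hx)
  simp only [zero_add, one_div, ← Complex.cpow_neg] at h2
  convert! h2 using 2 with k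
  have h3 : (k.factorial : ℂ) * Ring.choose ((lam : ℂ) + k - 1) k
      = (((ascPochhammer ℝ k).eval lam : ℝ) : ℂ) := by
    have := Ring.factorial_nsmul_multichoose_eq_ascPochhammer (lam : ℂ) k
    rw [Ring.choose, show (lam : ℂ) + k - 1 - k + 1 = lam by ring, ← nsmul_eq_mul, this,
      Polynomial.ascPochhammer_smeval_eq_eval, ← ascPochhammer_map Complex.ofRealHom,
      Polynomial.eval_map]
    exact Polynomial.eval₂_at_apply Complex.ofRealHom lam
  have hk : (k.factorial : ℂ) ≠ 0 := by exact_mod_cast k.factorial_ne_zero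
  rw [coeff, Complex.ofReal_div, ← h3]
  simp [FormalMultilinearSeries.ofScalars, -mul_eq_mul_left_iff, -mul_eq_mul_right_iff]
  field_simp

theorem summable_coeff (lam : ℝ) {x : ℂ} (hx : ‖x‖ < 1) :
    Summable fun k => ‖(coeff lam k : ℂ) * x ^ k‖ :=
  (hasSum_coeff lam hx).summable.norm

theorem hasSum_pi (n : ℕ) (a : Fin n → ℕ → ℂ) (b : Fin n → ℂ) (h : ∀ j, HasSum (a j) (b j)) :
    HasSum (fun m : Fin n → ℕ => ∏ j, a j (m j)) (∏ j, b j) := by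
  induction n with
  | zero => simp
  | succ n ih =>
    have ih := ih (fun j => a j.succ) (fun j => b j.succ) fun j => h j.succ
    have h0 := h 0
    have hs : Summable fun x : ℕ × (Fin n → ℕ) => a 0 x.1 * ∏ j, a (Fin.succ j) (x.2 j) :=
      summable_mul_of_summable_norm (f := a 0)
        (g := fun m : Fin n → ℕ => ∏ j, a (Fin.succ j) (m j)) h0.summable.norm ih.summable.norm
    have hm := h0.mul ih hs
    rw [Fin.prod_univ_succ, ← (Fin.consEquiv fun _ => ℕ).hasSum_iff]
    refine hm.congr_fun fun m => ?_
    simp [Fin.prod_univ_succ, Fin.consEquiv]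

/-! ### The polydisc and the weighted Bergman space -/

/-- The open unit polydisc in `ℂ ^ n`. -/
abbrev Polydisc (n : ℕ) : Type := {z : Fin n → ℂ // ∀ j, ‖z j‖ < 1}

/-- The action `(σ • z) j = z (σ⁻¹ j)` of the symmetric group on the polydisc. -/
def permAct {n : ℕ} (σ : Equiv.Perm (Fin n)) (z : Polydisc n) : Polydisc n :=
  ⟨fun j => z.1 (σ⁻¹ j), fun j => z.2 (σ⁻¹ j)⟩

/-- The kernel `K(z, w) = ∏ j, (1 - z j * conj (w j)) ^ (-lam)` on the polydisc. -/
def bergmanKernel (n : ℕ) (lam : ℝ) (z w : Polydisc n) : ℂ :=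
  ∏ j, (1 - z.1 j * conj (w.1 j)) ^ (-(lam : ℂ))

/-- The coefficient space: square summable families indexed by multi-indices. -/
abbrev Coeffs (n : ℕ) : Type := lp (fun _ : Fin n → ℕ => ℂ) 2

theorem norm_mul_conj_lt {a b : ℂ} (ha : ‖a‖ < 1) (hb : ‖b‖ < 1) : ‖a * conj b‖ < 1 := by
  rw [norm_mul, RCLike.norm_conj]
  nlinarith [norm_nonneg a, norm_nonneg b]

theorem hasSum_kernel (n : ℕ) (lam : ℝ) (z w : Polydisc n) :
    HasSum (fun m : Fin n → ℕ => ∏ j, ((coeff lam (m j) : ℂ) * (z.1 j * conj (w.1 j)) ^ m j))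
      (bergmanKernel n lam z w) :=
  hasSum_pi n (fun j k => (coeff lam k : ℂ) * (z.1 j * conj (w.1 j)) ^ k) _
    fun j => hasSum_coeff lam (norm_mul_conj_lt (z.2 j) (w.2 j))

/-- The coefficients of the kernel function at `z` in the normalized monomials. -/
def featureFun (n : ℕ) (lam : ℝ) (z : Polydisc n) (m : Fin n → ℕ) : ℂ :=
  ∏ j, ((Real.sqrt (coeff lam (m j)) : ℂ) * conj (z.1 j) ^ m j)

theorem conj_featureFun_mul {n : ℕ} {lam : ℝ} (hl : 0 < lam) (z w : Polydisc n)
    (m : Fin n → ℕ) : featureFun n lam w m * conj (featureFun n lam z m)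
      = ∏ j, ((coeff lam (m j) : ℂ) * (z.1 j * conj (w.1 j)) ^ m j) := by
  simp only [featureFun, map_prod, ← Finset.prod_mul_distrib]
  refine Finset.prod_congr rfl fun j _ => ?_
  have : (Real.sqrt (coeff lam (m j)) : ℂ) * (Real.sqrt (coeff lam (m j)) : ℂ)
      = (coeff lam (m j) : ℂ) := by
    exact_mod_cast congrArg Complex.ofReal (Real.mul_self_sqrt (coeff_pos hl (m j)).le)
  rw [← this]
  simp only [map_mul, map_pow, Complex.conj_conj, Complex.conj_ofReal]
  ring

theorem memℓp_featureFun {n : ℕ} {lam : ℝ} (hl : 0 < lam) (z : Polydisc n) :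
    Memℓp (featureFun n lam z) 2 := by
  refine memℓp_gen ?_
  have h := (hasSum_kernel n lam z z).summable.norm
  refine h.congr fun m => ?_
  rw [← conj_featureFun_mul hl, norm_mul, RCLike.norm_conj]
  simp [sq]

/-- The kernel function at `z` as an element of the coefficient space. -/
def feature (n : ℕ) {lam : ℝ} (hl : 0 < lam) (z : Polydisc n) : Coeffs n :=
  ⟨featureFun n lam z, memℓp_featureFun hl z⟩

theorem inner_feature (n : ℕ) {lam : ℝ} (hl : 0 < lam) (z w : Polydisc n) :
    ⟪feature n hl z, feature n hl w⟫_ℂ = bergmanKernel n lam z w := by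
  rw [lp.inner_eq_tsum, ← (hasSum_kernel n lam z w).tsum_eq]
  refine tsum_congr fun m => ?_
  rw [← conj_featureFun_mul hl]
  rfl

/-- The ratios appearing in multiplication by a coordinate. -/
def shiftWeight (lam : ℝ) (k : ℕ) : ℝ := Real.sqrt (coeff lam k / coeff lam (k + 1))

theorem shiftWeight_le {lam : ℝ} (hlam : 0 < lam) (k : ℕ) : shiftWeight lam k ≤ Real.sqrt (1 + 1 / lam) := by
  refine Real.sqrt_le_sqrt ?_
  have h := coeff_succ lam k
  have h1 := coeff_pos hlam k
  have h2 := coeff_pos hlam (k + 1)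
  rw [div_le_iff₀ h2]
  have h3 : (0 : ℝ) < lam + k := by positivity
  have h4 : coeff lam k = coeff lam (k + 1) * ((k + 1) / (lam + k)) := by
    field_simp
    linarith
  rw [h4, mul_comm (1 + 1 / lam)]
  refine mul_le_mul_of_nonneg_left ?_ h2.le
  rw [div_le_iff₀ h3]
  have : (1 + 1 / lam) * (lam + k) = lam + k + 1 + k / lam := by
    field_simp
    ring
  rw [this]
  have : 0 ≤ (k : ℝ) / lam := by positivity
  linarith

theorem shiftWeight_mul {lam : ℝ} (hlam : 0 < lam) (k : ℕ) :
    shiftWeight lam k * Real.sqrt (coeff lam (k + 1)) = Real.sqrt (coeff lam k) := by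
  rw [shiftWeight, ← Real.sqrt_mul (by
    have := coeff_pos hlam k
    have := coeff_pos hlam (k + 1)
    positivity), div_mul_cancel₀ _ (coeff_pos hlam (k + 1)).ne']

theorem exists_shift {n : ℕ} {lam : ℝ} (hlam : 0 < lam) (i : Fin n) :
    ∃ B : Coeffs n →L[ℂ] Coeffs n, ∀ z : Polydisc n,
      B (feature n hlam z) = conj (z.1 i) • feature n hlam z := by
  set C : ℝ := Real.sqrt (1 + 1 / lam) with hC
  have hC0 : 0 ≤ C := Real.sqrt_nonneg _
  let e : (Fin n → ℕ) → (Fin n → ℕ) := fun m => Function.update m i (m i + 1)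
  have he : Function.Injective e := by
    intro m m' h
    funext j
    have hj := congrFun h j
    by_cases hji : j = i
    · subst hji
      simpa [e] using hj
    · simpa [e, hji] using hj
  let b : (Fin n → ℕ) → ℂ := fun m => (shiftWeight lam (m i) : ℂ)
  have hb : ∀ m, ‖b m‖ ≤ C := fun m => by
    simp only [b, Complex.norm_real, Real.norm_eq_abs]
    rw [abs_of_nonneg (show 0 ≤ shiftWeight lam (m i) from Real.sqrt_nonneg _)]
    exact shiftWeight_le hlam _
  have hsq : ∀ x : Coeffs n, Summable fun m => ‖x m‖ ^ 2 := fun x => by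
    simpa using (lp.memℓp x).summable (by norm_num)
  have hle : ∀ (x : Coeffs n) m, ‖b m * x (e m)‖ ^ 2 ≤ C ^ 2 * ‖x (e m)‖ ^ 2 := fun x m => by
    rw [norm_mul, mul_pow]
    gcongr
    exact hb m
  have hs : ∀ x : Coeffs n, Summable fun m => C ^ 2 * ‖x (e m)‖ ^ 2 := fun x =>
    ((hsq x).comp_injective he).mul_left _
  have hs' : ∀ x : Coeffs n, Summable fun m => ‖b m * x (e m)‖ ^ 2 := fun x =>
    Summable.of_nonneg_of_le (fun _ => by positivity) (hle x) (hs x)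
  have hmem : ∀ x : Coeffs n, Memℓp (fun m => b m * x (e m)) 2 := fun x =>
    memℓp_gen (by simpa using hs' x)
  let B₀ : Coeffs n →ₗ[ℂ] Coeffs n :=
    { toFun := fun x => ⟨fun m => b m * x (e m), hmem x⟩
      map_add' := fun x y => by
        ext m
        exact mul_add _ _ _
      map_smul' := fun c x => by
        ext m
        exact mul_left_comm _ _ _ }
  have hnorm : ∀ x : Coeffs n, ‖x‖ ^ 2 = ∑' m, ‖x m‖ ^ 2 := fun x => by
    simpa using lp.norm_rpow_eq_tsum (p := 2) (by norm_num) x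
  refine ⟨B₀.mkContinuous C fun x => ?_, fun z => ?_⟩
  · refine (pow_le_pow_iff_left₀ (norm_nonneg _) (by positivity) two_ne_zero).mp ?_
    rw [hnorm, mul_pow, hnorm x, ← tsum_mul_left]
    refine (Summable.tsum_le_tsum (hle x) (hs' x) (hs x)).trans ?_
    rw [tsum_mul_left, tsum_mul_left]
    refine mul_le_mul_of_nonneg_left ?_ (by positivity)
    exact tsum_comp_le_tsum_of_inj (hsq x) (fun _ => by positivity) he
  · ext m
    change b m * featureFun n lam z (e m) = conj (z.1 i) * featureFun n lam z m
    have h1 : (shiftWeight lam (m i) : ℂ) * (Real.sqrt (coeff lam (m i + 1)) : ℂ)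
        = (Real.sqrt (coeff lam (m i)) : ℂ) := by
      exact_mod_cast congrArg Complex.ofReal (shiftWeight_mul hlam (m i))
    simp only [featureFun]
    rw [← Finset.mul_prod_erase _ _ (Finset.mem_univ i),
      ← Finset.mul_prod_erase _ (fun j => (Real.sqrt (coeff lam (m j)) : ℂ) * conj (z.1 j) ^ m j)
        (Finset.mem_univ i)]
    have h2 : ∏ j ∈ Finset.univ.erase i,
        ((Real.sqrt (coeff lam (e m j)) : ℂ) * conj (z.1 j) ^ e m j)
        = ∏ j ∈ Finset.univ.erase i,
          ((Real.sqrt (coeff lam (m j)) : ℂ) * conj (z.1 j) ^ m j) := by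
      refine Finset.prod_congr rfl fun j hj => ?_
      simp [e, Finset.ne_of_mem_erase hj]
    rw [h2, ← h1]
    simp only [e, b, Function.update_self, pow_succ]
    ring

instance posSemidef_bergmanKernel (n : ℕ) (lam : ℝ) [hl : Fact (0 < lam)] :
    Fact (kernelMatrix (bergmanKernel n lam)).PosSemidef :=
  ⟨posSemidef_of_feature _ (feature n hl.out) (inner_feature n hl.out)⟩

/-- The weighted Bergman space `𝔸^(lam)(𝔻ⁿ)`: the Hilbert space of functions on the polydisc with
reproducing kernel `bergmanKernel n lam`. -/
abbrev BergmanSpace (n : ℕ) (lam : ℝ) [Fact (0 < lam)] : Type :=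
  RKHS.OfKernel (kernelMatrix (bergmanKernel n lam))

section Operators

variable {n : ℕ} {lam : ℝ} [hl : Fact (0 < lam)]

/-- The reproducing property: `⟪K(·, w), K(·, z)⟫ = K(z, w)`, in Mathlib's convention that the inner
product is conjugate linear in the first variable. -/
theorem inner_kerFun_kerFun (z w : Polydisc n) :
    ⟪RKHS.kerFun (BergmanSpace n lam) z (1 : ℂ), RKHS.kerFun (BergmanSpace n lam) w (1 : ℂ)⟫_ℂ
      = bergmanKernel n lam z w := by
  rw [inner_kerFun_one, RKHS.kerFun_apply, RKHS.OfKernel.kernel_ofKernel]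
  simp [kernelMatrix]

theorem exists_permOp (σ : Equiv.Perm (Fin n)) :
    ∃ T : BergmanSpace n lam →L[ℂ] BergmanSpace n lam,
      ∀ (f : BergmanSpace n lam) (z : Polydisc n), T f z = f (permAct σ⁻¹ z) := by
  obtain ⟨S, hS⟩ := exists_isometry (H := BergmanSpace n lam)
    (fun z => RKHS.kerFun (BergmanSpace n lam) (permAct σ⁻¹ z) (1 : ℂ)) (fun z w => by
      rw [inner_kerFun_kerFun, inner_kerFun_kerFun]
      exact Equiv.prod_comp (σ⁻¹)⁻¹ fun j => (1 - z.1 j * conj (w.1 j)) ^ (-(lam : ℂ)))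
  refine ⟨S.toContinuousLinearMap.adjoint, fun f z => ?_⟩
  rw [← inner_kerFun_one, ContinuousLinearMap.adjoint_inner_right]
  simp only [LinearIsometry.coe_toContinuousLinearMap, hS]
  exact inner_kerFun_one _ _

/-- The operator `R σ : f ↦ f ∘ σ⁻¹` on the weighted Bergman space. -/
def permOp (n : ℕ) (lam : ℝ) [Fact (0 < lam)] (σ : Equiv.Perm (Fin n)) :
    BergmanSpace n lam →L[ℂ] BergmanSpace n lam :=
  Classical.choose (exists_permOp σ)

@[simp]
theorem permOp_apply (σ : Equiv.Perm (Fin n)) (f : BergmanSpace n lam) (z : Polydisc n) :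
    permOp n lam σ f z = f (permAct σ⁻¹ z) :=
  Classical.choose_spec (exists_permOp σ) f z

theorem exists_coordOp (i : Fin n) :
    ∃ T : BergmanSpace n lam →L[ℂ] BergmanSpace n lam,
      ∀ (f : BergmanSpace n lam) (z : Polydisc n), T f z = z.1 i * f z := by
  obtain ⟨S, hS⟩ := exists_isometry (H := BergmanSpace n lam) (feature n hl.out) (fun z w => by
    rw [inner_kerFun_kerFun, inner_feature])
  obtain ⟨B, hB⟩ := exists_shift hl.out i
  refine ⟨S.toContinuousLinearMap.adjoint ∘L B.adjoint ∘L S.toContinuousLinearMap, fun f z => ?_⟩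
  rw [← inner_kerFun_one]
  simp only [ContinuousLinearMap.comp_apply, ContinuousLinearMap.adjoint_inner_right,
    LinearIsometry.coe_toContinuousLinearMap, hS, hB, inner_smul_left, Complex.conj_conj]
  rw [← hS, S.inner_map_map, inner_kerFun_one]

theorem exists_mulOp (p : MvPolynomial (Fin n) ℂ) :
    ∃ T : BergmanSpace n lam →L[ℂ] BergmanSpace n lam,
      ∀ (f : BergmanSpace n lam) (z : Polydisc n), T f z = MvPolynomial.eval z.1 p * f z := by
  induction p using MvPolynomial.induction_on with
  | C a => exact ⟨a • ContinuousLinearMap.id ℂ _, fun f z => by simp⟩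
  | add p q hp hq =>
    obtain ⟨S, hS⟩ := hp
    obtain ⟨T, hT⟩ := hq
    exact ⟨S + T, fun f z => by simp [hS, hT, add_mul]⟩
  | mul_X p i hp =>
    obtain ⟨S, hS⟩ := hp
    obtain ⟨T, hT⟩ := exists_coordOp (lam := lam) i
    exact ⟨S ∘L T, fun f z => by simp [hS, hT, mul_assoc]⟩

/-- The operator `f ↦ p · f` of pointwise multiplication by a polynomial. -/
def mulOp (n : ℕ) (lam : ℝ) [Fact (0 < lam)] (p : MvPolynomial (Fin n) ℂ) :
    BergmanSpace n lam →L[ℂ] BergmanSpace n lam :=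
  Classical.choose (exists_mulOp p)

@[simp]
theorem mulOp_apply (p : MvPolynomial (Fin n) ℂ) (f : BergmanSpace n lam) (z : Polydisc n) :
    mulOp n lam p f z = MvPolynomial.eval z.1 p * f z :=
  Classical.choose_spec (exists_mulOp p) f z

end Operators

/-! ### Hilbert modules and local freeness -/

/-- A Hilbert module structure on the Hilbert space `H` over the complex algebra `R`: a homomorphism
from `R` to the bounded operators on `H`. -/
abbrev HilbertModule (R H : Type*) [CommRing R] [Algebra ℂ R] [NormedAddCommGroup H]
    [InnerProductSpace ℂ H] [CompleteSpace H] :=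
  R →ₐ[ℂ] (H →L[ℂ] H)

namespace HilbertModule

section General

variable {R H : Type*} [CommRing R] [Algebra ℂ R]
  [NormedAddCommGroup H] [InnerProductSpace ℂ H] [CompleteSpace H]

/-- The restriction of a Hilbert module to a closed invariant subspace. -/
def sub (ρ : HilbertModule R H) (V : Submodule ℂ H) [CompleteSpace V]
    (hV : ∀ r, ∀ v ∈ V, ρ r v ∈ V) : HilbertModule R V where
  toFun r := (ρ r ∘L V.subtypeL).codRestrict V fun v => hV r v v.2
  map_one' := ContinuousLinearMap.ext fun v => Subtype.ext (by simp)
  map_mul' r s := ContinuousLinearMap.ext fun v => Subtype.ext (by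
    simp only [map_mul]
    rfl)
  map_zero' := ContinuousLinearMap.ext fun v => Subtype.ext (by simp)
  map_add' r s := ContinuousLinearMap.ext fun v => Subtype.ext (by
    simp only [map_add]
    rfl)
  commutes' c := ContinuousLinearMap.ext fun v => Subtype.ext (by
    simp [Algebra.algebraMap_eq_smul_one])

end General

section LocallyFree

variable {n : ℕ} {H : Type*} [NormedAddCommGroup H] [InnerProductSpace ℂ H] [CompleteSpace H]

/-- The span of all `p · f - p(w) f`, for polynomials `p` and `f` in the module. -/
def nullSpace (ρ : HilbertModule (MvPolynomial (Fin n) ℂ) H) (w : Fin n → ℂ) : Submodule ℂ H :=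
  Submodule.span ℂ {x | ∃ (p : MvPolynomial (Fin n) ℂ) (f : H),
    x = ρ p f - MvPolynomial.eval w p • f}

/-- The module tensor product `H ⊗ ℂ_w`, realized as the orthogonal complement in `H ≅ H ⊗ ℂ` of
the subspace by which the Hilbert space tensor product is divided. -/
def tensorPoint (ρ : HilbertModule (MvPolynomial (Fin n) ℂ) H) (w : Fin n → ℂ) : Submodule ℂ H :=
  (nullSpace ρ w)ᗮ

/-- The set of all `z` whose coordinatewise conjugate lies in `Ω`. -/
def conjSet (Ω : Set (Fin n → ℂ)) : Set (Fin n → ℂ) := {z | (fun j => conj (z j)) ∈ Ω}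

/-- Local freeness of rank `k` at the point `w` of the conjugate domain of `Ω`: near `w` there are
`k` holomorphic functions with values in `H` which form, at each point `z`, a basis of the module
tensor product at the point of `Ω` conjugate to `z`. -/
def IsLocallyFreeAt (ρ : HilbertModule (MvPolynomial (Fin n) ℂ) H) (Ω : Set (Fin n → ℂ)) (k : ℕ)
    (w : Fin n → ℂ) : Prop :=
  ∃ U : Set (Fin n → ℂ), IsOpen U ∧ w ∈ U ∧ U ⊆ conjSet Ω ∧
    ∃ γ : Fin k → (Fin n → ℂ) → H, (∀ i, DifferentiableOn ℂ (γ i) U) ∧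
      ∀ z ∈ U, LinearIndependent ℂ (fun i => γ i z) ∧
        Submodule.span ℂ (Set.range fun i => γ i z) = tensorPoint ρ fun j => conj (z j)

/-- Local freeness of rank `k` on `Ω`. -/
def IsLocallyFreeOn (ρ : HilbertModule (MvPolynomial (Fin n) ℂ) H) (Ω : Set (Fin n → ℂ))
    (k : ℕ) : Prop :=
  ∀ w ∈ conjSet Ω, IsLocallyFreeAt ρ Ω k w

/-- A Hilbert module over the symmetric polynomials in `n` variables, as a Hilbert module over the
polynomial ring in `n` variables, whose variables act as the elementary symmetric polynomials. -/
def ofSymmetric (ρ : HilbertModule (MvPolynomial.symmetricSubalgebra (Fin n) ℂ) H) :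
    HilbertModule (MvPolynomial (Fin n) ℂ) H :=
  ρ.comp (MvPolynomial.esymmAlgHom (Fin n) ℂ n)

end LocallyFree

end HilbertModule

/-- The symmetrization map `z ↦ (s 1 z, …, s n z)` given by the elementary symmetric polynomials. -/
def symmetrization (n : ℕ) (z : Fin n → ℂ) : Fin n → ℂ :=
  fun k => MvPolynomial.eval z (MvPolynomial.esymm (Fin n) ℂ (k + 1))

/-- The symmetrized polydisc: the image of the polydisc under the symmetrization map. -/
def symmetrizedPolydisc (n : ℕ) : Set (Fin n → ℂ) :=
  symmetrization n '' {z | ∀ j, ‖z j‖ < 1}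

/-! ### The isotypic submodules for the one-dimensional characters -/

section Isotypic

variable (n : ℕ) (lam : ℝ) [hl : Fact (0 < lam)]

/-- The weighted Bergman space as a Hilbert module over the symmetric polynomials, acting by
pointwise multiplication. -/
def bergmanModule :
    HilbertModule (MvPolynomial.symmetricSubalgebra (Fin n) ℂ) (BergmanSpace n lam) where
  toFun p := mulOp n lam p.1
  map_one' := by ext f z; simp
  map_mul' p q := by ext f z; simp [mul_assoc]
  map_zero' := by ext f z; simp
  map_add' p q := by ext f z; simp [add_mul]
  commutes' c := by ext f z; simp [Algebra.algebraMap_eq_smul_one]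

/-- The operator `f ↦ χ(1) / n! * ∑ σ, conj (χ σ) * (f ∘ σ⁻¹)` attached to a function `χ` on the
symmetric group. -/
def isotypicProj (χ : Equiv.Perm (Fin n) → ℂ) : BergmanSpace n lam →L[ℂ] BergmanSpace n lam :=
  (χ 1 / (n.factorial : ℂ)) • ∑ σ : Equiv.Perm (Fin n), conj (χ σ) • permOp n lam σ

/-- The range of the operator `isotypicProj` on the weighted Bergman space. -/
def isotypicSubspace (χ : Equiv.Perm (Fin n) → ℂ) : Submodule ℂ (BergmanSpace n lam) :=
  LinearMap.range (isotypicProj n lam χ).toLinearMap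

variable {n lam}

theorem permOp_mul (σ τ : Equiv.Perm (Fin n)) (f : BergmanSpace n lam) :
    permOp n lam (σ * τ) f = permOp n lam σ (permOp n lam τ f) := by
  ext z
  simp [permAct]

theorem permOp_mulOp {p : MvPolynomial (Fin n) ℂ} (hp : p.IsSymmetric)
    (σ : Equiv.Perm (Fin n)) (f : BergmanSpace n lam) :
    permOp n lam σ (mulOp n lam p f) = mulOp n lam p (permOp n lam σ f) := by
  ext z
  have h : MvPolynomial.eval (permAct σ⁻¹ z).1 p = MvPolynomial.eval z.1 p := by
    conv_rhs => rw [← hp (σ⁻¹)⁻¹]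
    rw [MvPolynomial.eval_rename]
    rfl
  simp [h]

theorem bergmanModule_mem_isotypicSubspace (χ : Equiv.Perm (Fin n) → ℂ)
    (p : MvPolynomial.symmetricSubalgebra (Fin n) ℂ) (f : BergmanSpace n lam)
    (hf : f ∈ isotypicSubspace n lam χ) :
    bergmanModule n lam p f ∈ isotypicSubspace n lam χ := by
  obtain ⟨g, rfl⟩ := hf
  refine ⟨mulOp n lam p.1 g, ?_⟩
  change isotypicProj n lam χ (mulOp n lam p.1 g) = mulOp n lam p.1 (isotypicProj n lam χ g)
  simp [isotypicProj, permOp_mulOp p.2]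

/-- For a one-dimensional character `χ`, the isotypic subspace consists of the functions with
`f ∘ σ⁻¹ = χ σ • f` for all `σ`. -/
theorem mem_isotypicSubspace_iff (χ : Equiv.Perm (Fin n) →* ℂ) (f : BergmanSpace n lam) :
    f ∈ isotypicSubspace n lam χ ↔ ∀ σ, permOp n lam σ f = χ σ • f := by
  have hχ : ∀ σ, conj (χ σ) * χ σ = 1 := fun σ => by
    have h1 : ‖χ σ‖ = 1 := Complex.norm_eq_one_of_pow_eq_one
      (by rw [← map_pow, pow_orderOf_eq_one, map_one]) (orderOf_pos σ).ne'
    rw [mul_comm, Complex.mul_conj, Complex.normSq_eq_norm_sq, h1]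
    simp
  constructor
  · rintro ⟨g, rfl⟩ τ
    change permOp n lam τ (isotypicProj n lam χ g) = χ τ • isotypicProj n lam χ g
    simp only [isotypicProj, smul_apply, sum_apply,
      map_smul, map_sum, ← permOp_mul]
    rw [smul_comm (χ τ)]
    congr 1
    rw [Finset.smul_sum, ← Equiv.sum_comp (Equiv.mulLeft τ)
      fun σ => χ τ • conj (χ σ) • permOp n lam σ g]
    refine Finset.sum_congr rfl fun σ _ => ?_
    rw [Equiv.coe_mulLeft, map_mul, map_mul, smul_smul, ← mul_assoc, mul_comm (χ τ), hχ, one_mul]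
  · intro h
    refine ⟨f, ?_⟩
    change isotypicProj n lam χ f = f
    simp only [isotypicProj, smul_apply, sum_apply, h,
      smul_smul, hχ, one_smul, map_one]
    rw [Finset.sum_const, Finset.card_univ, Fintype.card_perm, Fintype.card_fin,
      ← Nat.cast_smul_eq_nsmul ℂ, smul_smul, one_div, inv_mul_cancel₀, one_smul]
    exact_mod_cast n.factorial_ne_zero

instance completeSpace_isotypicSubspace (χ : Equiv.Perm (Fin n) →* ℂ) :
    CompleteSpace (isotypicSubspace n lam χ) := by
  have h : IsClosed (isotypicSubspace n lam χ : Set (BergmanSpace n lam)) := by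
    have : (isotypicSubspace n lam χ : Set (BergmanSpace n lam))
        = ⋂ σ, {f | permOp n lam σ f = χ σ • f} := by
      ext f
      simp [mem_isotypicSubspace_iff]
    rw [this]
    exact isClosed_iInter fun σ => isClosed_eq (permOp n lam σ).continuous (continuous_const_smul _)
  exact h.completeSpace_coe

variable (n lam)

/-- The submodule of the weighted Bergman space attached to a one-dimensional character, as a
Hilbert module over the symmetric polynomials. -/
def isotypicModule (χ : Equiv.Perm (Fin n) →* ℂ) :
    HilbertModule (MvPolynomial.symmetricSubalgebra (Fin n) ℂ) (isotypicSubspace n lam χ) :=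
  (bergmanModule n lam).sub (isotypicSubspace n lam χ) (bergmanModule_mem_isotypicSubspace χ)

end Isotypic

/-- The trivial character of the symmetric group, belonging to the partition `(n)`. -/
def trivialChar (n : ℕ) : Equiv.Perm (Fin n) →* ℂ := 1

/-- The sign character of the symmetric group, belonging to the partition `(1, …, 1)`. -/
def signChar (n : ℕ) : Equiv.Perm (Fin n) →* ℂ where
  toFun σ := ((Equiv.Perm.sign σ : ℤ) : ℂ)
  map_one' := by simp
  map_mul' σ τ := by simp

end SymPolydisc

end

noncomputable section

namespace SymPolydisc

open scoped ComplexConjugate InnerProductSpace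

/-! ### Weakly holomorphic maps into a Hilbert space -/

/-! Both modules are cyclic over the symmetric polynomials. Polynomials are dense in the weighted
Bergman space and the isotypic projection maps polynomials to polynomials, so it is enough to
describe the polynomials that transform by the character. They are `D * q` with `q` symmetric, where
`D = 1` for the trivial character and `D` is the Vandermonde polynomial for the sign. As `q` is a
polynomial in the elementary symmetric polynomials, the vectors `p · D` are dense
(`denseRange_smul_vector`).

For a cyclic module with generator `e`, a vector orthogonal to all `p · f - p(u) f` is determined by
its pairing with `e`. The fibre at `u` is therefore a line as soon as `p ↦ p(u)` is bounded by a
multiple of the norm of `p · e`, and it is spanned by the Riesz vector of this evaluation. If the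
bound is locally uniform in `u`, these vectors depend holomorphically on the conjugate of `u`: they
are locally bounded, and their pairings with a dense set are polynomials
(`isLocallyFreeAt_of_cyclic`).

The bound must survive at points where `D` vanishes (`exists_norm_eval_le`). For `u = s(a)` with all
`‖a j‖ < r < 1`, the maximum principle bounds `q(a) = p(u)` by the values of `q` on a torus with
pairwise distinct radii in `[r, 1)`. Points of that torus have distinct coordinates, so `D` is
bounded below there, while `D * q` is bounded above by its Bergman norm. The resulting
neighbourhoods are open because the images of smaller polydiscs under `s` are open
(`isOpen_symmetrization_image`). -/

/-- The quadratic Taylor estimate for a bounded holomorphic function on a ball. -/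
theorem norm_sub_sub_fderiv_le {E : Type*} [NormedAddCommGroup E] [NormedSpace ℂ E] {f : E → ℂ}
    {c h : E} {R M : ℝ} (hf : DifferentiableOn ℂ f (Metric.ball c R))
    (hM : ∀ z ∈ Metric.ball c R, ‖f z‖ ≤ M) (hh : ‖h‖ < R) :
    ‖f (c + h) - f c - fderiv ℂ f c h‖ ≤ 4 * M * (‖h‖ / R) ^ 2 := by
  have hR : 0 < R := (norm_nonneg h).trans_lt hh
  have hM0 : 0 ≤ M := (norm_nonneg _).trans (hM c (Metric.mem_ball_self hR))
  rcases eq_or_ne h 0 with rfl | hne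
  · simp
  have hn : 0 < ‖h‖ := norm_pos_iff.mpr hne
  have hmem : ∀ t ∈ Metric.ball (0 : ℂ) (R / ‖h‖), c + t • h ∈ Metric.ball c R := by
    intro t ht
    rw [mem_ball_zero_iff, lt_div_iff₀ hn] at ht
    simpa [mem_ball_iff_norm, norm_smul] using ht
  -- Slice along the complex line through `c` and `c + h`. The Schwarz lemma is applied on a disc of
  -- radius `R / ‖h‖`, first to `g` to bound its difference quotient, then to that quotient; each
  -- application contributes a factor `‖h‖ / R` and a factor 2.
  let g : ℂ → ℂ := fun t => f (c + t • h)
  have hg : DifferentiableOn ℂ g (Metric.ball 0 (R / ‖h‖)) :=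
    hf.comp (by fun_prop) hmem
  have h0 : (0 : ℂ) ∈ Metric.ball (0 : ℂ) (R / ‖h‖) := Metric.mem_ball_self (by positivity)
  have h1 : (1 : ℂ) ∈ Metric.ball (0 : ℂ) (R / ‖h‖) := by
    simpa [one_lt_div hn] using hh
  have hball : Metric.ball (0 : ℂ) (R / ‖h‖) ∈ nhds 0 := Metric.ball_mem_nhds _ (by positivity)
  have hmaps : Set.MapsTo g (Metric.ball 0 (R / ‖h‖)) (Metric.closedBall (g 0) (2 * M)) := by
    intro t ht
    rw [Metric.mem_closedBall, dist_eq_norm, two_mul]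
    exact (norm_sub_le _ _).trans (add_le_add (hM _ (hmem t ht)) (hM _ (hmem 0 h0)))
  have hk : ∀ t ∈ Metric.ball (0 : ℂ) (R / ‖h‖), ‖dslope g 0 t‖ ≤ 2 * M / (R / ‖h‖) :=
    fun t ht => Complex.norm_dslope_le_div_of_mapsTo_ball hg hmaps ht
  have hkd : DifferentiableOn ℂ (dslope g 0) (Metric.ball 0 (R / ‖h‖)) :=
    (Complex.differentiableOn_dslope hball).mpr hg
  have hmaps' : Set.MapsTo (dslope g 0) (Metric.ball 0 (R / ‖h‖))
      (Metric.closedBall (dslope g 0 0) (2 * (2 * M / (R / ‖h‖)))) := by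
    intro t ht
    rw [Metric.mem_closedBall, dist_eq_norm, two_mul]
    exact (norm_sub_le _ _).trans (add_le_add (hk t ht) (hk 0 h0))
  have key := Complex.dist_le_div_mul_dist_of_mapsTo_ball hkd hmaps' h1
  have hd : deriv g 0 = fderiv ℂ f c h := by
    have hfc : HasFDerivAt f (fderiv ℂ f c) (c + (0 : ℂ) • h) := by
      simpa using (hf.differentiableAt (Metric.ball_mem_nhds c hR)).hasFDerivAt
    have hl : HasDerivAt (fun t : ℂ => c + t • h) h 0 := by
      simpa using ((hasDerivAt_id (0 : ℂ)).smul_const h).const_add c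
    exact (hfc.comp_hasDerivAt 0 hl).deriv
  rw [dslope_same, dslope_of_ne _ one_ne_zero, slope_def_module, hd, dist_eq_norm, dist_eq_norm]
    at key
  simp only [sub_zero, inv_one, one_smul, norm_one, mul_one, g, zero_smul, add_zero] at key
  refine key.trans_eq ?_
  field_simp
  ring

section Dense

variable {P H : Type*} [NormedAddCommGroup H] [InnerProductSpace ℂ H]

theorem eq_of_inner_eq {φ : P → H} (hφ : DenseRange φ) {x y : H}
    (h : ∀ p, ⟪x, φ p⟫_ℂ = ⟪y, φ p⟫_ℂ) : x = y := by
  refine ext_inner_right ℂ fun v => ?_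
  exact hφ.induction_on (p := fun v => ⟪x, v⟫_ℂ = ⟪y, v⟫_ℂ) v
    (isClosed_eq (by fun_prop) (by fun_prop)) h

theorem norm_le_of_inner_le {φ : P → H} (hφ : DenseRange φ) {x : H} {C : ℝ} (hC : 0 ≤ C)
    (h : ∀ p, ‖⟪x, φ p⟫_ℂ‖ ≤ C * ‖φ p‖) : ‖x‖ ≤ C := by
  have h1 : ‖⟪x, x⟫_ℂ‖ ≤ C * ‖x‖ :=
    hφ.induction_on (p := fun v => ‖⟪x, v⟫_ℂ‖ ≤ C * ‖v‖) x
      (isClosed_le (by fun_prop) (by fun_prop)) h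
  rw [inner_self_eq_norm_sq_to_K] at h1
  rcases (norm_nonneg x).eq_or_lt with h0 | h0
  · rwa [← h0]
  · refine le_of_mul_le_mul_right ?_ h0
    simpa [sq] using h1

end Dense

section Riesz

variable {P H : Type*} [AddCommGroup P] [Module ℂ P] [NormedAddCommGroup H]
  [InnerProductSpace ℂ H] [CompleteSpace H]

/-- A functional which is bounded with respect to the norm of the image under a linear map with
dense range is represented by a vector. -/
theorem exists_inner_eq {φ : P →ₗ[ℂ] H} (hφ : DenseRange φ) (l : P →ₗ[ℂ] ℂ) {C : ℝ} (hC : 0 ≤ C)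
    (hl : ∀ p, ‖l p‖ ≤ C * ‖φ p‖) : ∃ g : H, ‖g‖ ≤ C ∧ ∀ p, ⟪g, φ p⟫_ℂ = l p := by
  refine ⟨(InnerProductSpace.toDual ℂ H).symm (l.extendOfNorm φ), ?_, fun p => ?_⟩
  · rw [LinearIsometryEquiv.norm_map]
    exact LinearMap.opNorm_extendOfNorm_le hφ hC hl
  · rw [InnerProductSpace.toDual_symm_apply, LinearMap.extendOfNorm_eq hφ ⟨C, hl⟩]

/-- A bounded map into a Hilbert space whose pairings with a dense set of vectors are holomorphic
is holomorphic. -/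
theorem differentiableOn_of_inner {E : Type*} [NormedAddCommGroup E] [NormedSpace ℂ E]
    {φ : P →ₗ[ℂ] H} (hφ : DenseRange φ) {U : Set E} (hU : IsOpen U) {γ : E → H} {C : ℝ}
    (hC : ∀ z ∈ U, ‖γ z‖ ≤ C) (hd : ∀ p, DifferentiableOn ℂ (fun z => ⟪φ p, γ z⟫_ℂ) U) :
    DifferentiableOn ℂ γ U := by
  intro c hc
  obtain ⟨R, hR, hsub⟩ := Metric.isOpen_iff.mp hU c hc
  have hC0 : 0 ≤ C := (norm_nonneg _).trans (hC c hc)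
  let f : P → E → ℂ := fun p z => ⟪φ p, γ z⟫_ℂ
  have hfd : ∀ p, DifferentiableOn ℂ (f p) (Metric.ball c R) := fun p => (hd p).mono hsub
  have hfa : ∀ p, DifferentiableAt ℂ (f p) c := fun p =>
    (hfd p).differentiableAt (Metric.ball_mem_nhds c hR)
  have hfM : ∀ p, ∀ z ∈ Metric.ball c R, ‖f p z‖ ≤ C * ‖φ p‖ := fun p z hz =>
    (norm_inner_le_norm _ _).trans (by
      rw [mul_comm]
      exact mul_le_mul_of_nonneg_right (hC z (hsub hz)) (norm_nonneg _))
  have hbound : ∀ p, ‖fderiv ℂ (f p) c‖ ≤ 2 * (C * ‖φ p‖) / R := fun p =>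
    Complex.norm_fderiv_le_div_of_mapsTo_ball (hfd p) (fun z hz => by
      rw [Metric.mem_closedBall, dist_eq_norm, two_mul]
      exact (norm_sub_le _ _).trans
        (add_le_add (hfM p z hz) (hfM p c (Metric.mem_ball_self hR)))) hR
  -- The weak derivatives in direction `v` are conjugate linear in `p` and bounded by a multiple of
  -- `‖φ p‖`, so their conjugates are represented by one vector: the value at `v` of the candidate
  -- derivative.
  have hex : ∀ v : E, ∃ g : H, ‖g‖ ≤ 2 * C / R * ‖v‖ ∧
      ∀ p, ⟪g, φ p⟫_ℂ = conj (fderiv ℂ (f p) c v) := by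
    intro v
    let l : P →ₗ[ℂ] ℂ :=
      { toFun := fun p => conj (fderiv ℂ (f p) c v)
        map_add' := fun p q => by
          have : f (p + q) = f p + f q := by
            ext z
            simp [f]
          rw [this, fderiv_add (hfa p) (hfa q)]
          simp
        map_smul' := fun a p => by
          have : f (a • p) = conj a • f p := by
            ext z
            simp [f, mul_comm]
          rw [this, fderiv_const_smul (hfa p)]
          simp }
    refine exists_inner_eq hφ l (by positivity) fun p => ?_
    change ‖conj (fderiv ℂ (f p) c v)‖ ≤ _
    rw [RCLike.norm_conj]
    refine ((fderiv ℂ (f p) c).le_opNorm v).trans ?_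
    refine (mul_le_mul_of_nonneg_right (hbound p) (norm_nonneg v)).trans_eq ?_
    ring
  choose g hg hgi using hex
  let L : E →ₗ[ℂ] H :=
    { toFun := g
      map_add' := fun v w => eq_of_inner_eq hφ fun p => by
        simp [hgi]
      map_smul' := fun a v => eq_of_inner_eq hφ fun p => by
        simp [hgi, mul_comm] }
  let L' : E →L[ℂ] H := L.mkContinuous (2 * C / R) hg
  -- The scalar Taylor remainder is at most a constant times `‖φ p‖`, uniformly in `p`; density then
  -- turns it into a norm estimate.
  have hest : ∀ h : E, ‖h‖ < R → ‖γ (c + h) - γ c - L' h‖ ≤ 4 * C * (‖h‖ / R) ^ 2 := by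
    intro h hh
    refine norm_le_of_inner_le hφ (by positivity) fun p => ?_
    have h2 := norm_sub_sub_fderiv_le (hfd p) (hfM p) hh
    have h3 : ⟪γ (c + h) - γ c - L' h, φ p⟫_ℂ
        = conj (f p (c + h) - f p c - fderiv ℂ (f p) c h) := by
      have : ⟪L' h, φ p⟫_ℂ = conj (fderiv ℂ (f p) c h) := hgi h p
      simp only [inner_sub_left, this, map_sub, f, inner_conj_symm]
    rw [h3, RCLike.norm_conj]
    refine h2.trans_eq ?_
    ring
  have : HasFDerivAt γ L' c := by
    rw [hasFDerivAt_iff_isLittleO_nhds_zero]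
    have hO : (fun h : E => γ (c + h) - γ c - L' h) =O[nhds 0] fun h => ‖h‖ ^ 2 := by
      refine Asymptotics.IsBigO.of_bound (4 * C / R ^ 2) ?_
      filter_upwards [Metric.ball_mem_nhds (0 : E) hR] with h hh
      refine (hest h (by simpa using hh)).trans_eq ?_
      rw [norm_pow, norm_norm]
      ring
    refine hO.trans_isLittleO ?_
    simpa using (Asymptotics.isLittleO_norm_pow_id (E' := E) one_lt_two)
  exact this.differentiableAt.differentiableWithinAt

end Riesz

/-! ### Cyclic Hilbert modules with bounded point evaluations -/

theorem differentiable_eval {n : ℕ} (p : MvPolynomial (Fin n) ℂ) :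
    Differentiable ℂ fun z : Fin n → ℂ => MvPolynomial.eval z p := by
  induction p using MvPolynomial.induction_on with
  | C a => simp
  | add p q hp hq =>
    simp only [map_add]
    fun_prop
  | mul_X p i hp =>
    simp only [map_mul, MvPolynomial.eval_X]
    fun_prop

namespace HilbertModule

variable {n : ℕ} {H : Type*} [NormedAddCommGroup H] [InnerProductSpace ℂ H] [CompleteSpace H]

/-- The vector representing a bounded point evaluation on a cyclic module spans the module tensor
product at that point. -/
theorem tensorPoint_eq_span (ρ : HilbertModule (MvPolynomial (Fin n) ℂ) H) {e g : H}
    (he : DenseRange fun p => ρ p e) {u : Fin n → ℂ}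
    (hg : ∀ p, ⟪g, ρ p e⟫_ℂ = MvPolynomial.eval u p) : tensorPoint ρ u = Submodule.span ℂ {g} := by
  refine le_antisymm (fun x hx => ?_) ?_
  · rw [Submodule.mem_span_singleton]
    -- The coefficient is forced by the pairing with `e` itself.
    refine ⟨⟪e, x⟫_ℂ, eq_of_inner_eq he fun p => ?_⟩
    have h := Submodule.inner_left_of_mem_orthogonal
      (Submodule.subset_span ⟨p, e, rfl⟩ : ρ p e - MvPolynomial.eval u p • e ∈ nullSpace ρ u) hx
    rw [inner_sub_right, inner_smul_right, sub_eq_zero] at h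
    rw [inner_smul_left, hg, inner_conj_symm, h, mul_comm]
  · rw [Submodule.span_singleton_le_iff_mem, tensorPoint, nullSpace, Submodule.mem_orthogonal']
    intro y hy
    refine Submodule.span_induction (p := fun y _ => ⟪g, y⟫_ℂ = 0) ?_ (by simp)
      (fun x y _ _ hx hy => by rw [inner_add_right, hx, hy, add_zero])
      (fun a x _ hx => by rw [inner_smul_right, hx, mul_zero]) hy
    rintro _ ⟨p, f, rfl⟩
    -- By density it suffices to take `f = ρ q e`, where the claim is multiplicativity of evaluation
    -- at `u`.
    refine he.induction_on (p := fun f => ⟪g, ρ p f - MvPolynomial.eval u p • f⟫_ℂ = 0) f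
      (isClosed_eq (by fun_prop) (by fun_prop)) fun q => ?_
    have : ρ p (ρ q e) = ρ (p * q) e := by
      rw [map_mul]
      rfl
    rw [inner_sub_right, inner_smul_right, this, hg, hg, map_mul, sub_self]

/-- A cyclic Hilbert module is locally free of rank one wherever the point evaluations are locally
uniformly bounded. -/
theorem isLocallyFreeAt_of_cyclic (ρ : HilbertModule (MvPolynomial (Fin n) ℂ) H) {e : H}
    (he : DenseRange fun p => ρ p e) {Ω W : Set (Fin n → ℂ)} (hW : IsOpen W) (hWΩ : W ⊆ Ω) {C : ℝ}
    (hC : ∀ u ∈ W, ∀ p, ‖MvPolynomial.eval u p‖ ≤ C * ‖ρ p e‖) {w : Fin n → ℂ}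
    (hw : (fun j => conj (w j)) ∈ W) : IsLocallyFreeAt ρ Ω 1 w := by
  have hC0 : 0 ≤ C := by
    by_contra! h
    have h1 := hC _ hw 1
    rw [map_one, norm_one] at h1
    nlinarith [norm_nonneg (ρ 1 e)]
  let φ : MvPolynomial (Fin n) ℂ →ₗ[ℂ] H :=
    { toFun := fun p => ρ p e
      map_add' := fun p q => by rw [map_add]; rfl
      map_smul' := fun a p => by rw [map_smul]; rfl }
  have hφ : DenseRange φ := he
  have hex : ∀ u, ∃ g : H, u ∈ W → ‖g‖ ≤ C ∧ ∀ p, ⟪g, ρ p e⟫_ℂ = MvPolynomial.eval u p := by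
    intro u
    by_cases hu : u ∈ W
    · obtain ⟨g, hg⟩ := exists_inner_eq hφ (MvPolynomial.aeval u).toLinearMap hC0 fun p => hC u hu p
      exact ⟨g, fun _ => hg⟩
    -- The value off `W` is arbitrary and never used.
    · exact ⟨0, fun h => absurd h hu⟩
  choose g hg using hex
  have hU : IsOpen (conjSet W) := hW.preimage (by fun_prop)
  refine ⟨conjSet W, hU, hw, fun z hz => hWΩ hz, fun _ z => g fun j => conj (z j), fun _ => ?_,
    fun z hz => ⟨?_, ?_⟩⟩
  · refine differentiableOn_of_inner hφ hU (C := C) (fun z hz => (hg _ hz).1) fun p => ?_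
    -- Conjugating both the point and the value of `p` amounts to conjugating its coefficients, so
    -- the pairing is a polynomial in `z`.
    have h1 : DifferentiableOn ℂ
        (fun z : Fin n → ℂ => MvPolynomial.eval z (MvPolynomial.map (starRingEnd ℂ) p))
        (conjSet W) := (differentiable_eval _).differentiableOn
    refine h1.congr fun z hz => ?_
    change ⟪ρ p e, _⟫_ℂ = _
    rw [← inner_conj_symm, (hg _ hz).2 p, MvPolynomial.map_eval]
    congr 2
    ext j
    simp
  · rw [linearIndependent_unique_iff]
    intro h0
    have h1 := (hg _ hz).2 1
    rw [show g (fun j => conj (z j)) = 0 from h0, inner_zero_left, map_one] at h1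
    exact zero_ne_one h1
  · rw [Set.range_const, tensorPoint_eq_span ρ he (hg _ hz).2]

end HilbertModule

/-! ### The symmetrization map -/

/-- Viète's formula: `symmetrization n z` lists the non-leading coefficients of the monic polynomial
with roots `-z i`. Index `k` carries the elementary symmetric polynomial of degree `k + 1`, hence
the exponent `n - 1 - k`. -/
theorem prod_add_eq {n : ℕ} (z : Fin n → ℂ) (t : ℂ) :
    ∏ i, (t + z i) = t ^ n + ∑ k : Fin n, symmetrization n z k * t ^ (n - 1 - k : ℕ) := by
  have h := congrArg (fun p => Polynomial.eval t (p.map (MvPolynomial.eval z)))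
    (MvPolynomial.prod_C_add_X_eq_sum_esymm ℂ (Fin n))
  simp only [Polynomial.map_prod, Polynomial.map_add, Polynomial.map_X, Polynomial.map_C,
    MvPolynomial.eval_X, Polynomial.eval_prod, Polynomial.eval_add, Polynomial.eval_X,
    Polynomial.eval_C, Polynomial.map_sum, Polynomial.map_mul, Polynomial.map_pow,
    Polynomial.eval_finsetSum, Polynomial.eval_mul, Polynomial.eval_pow, Fintype.card_fin,
    Finset.sum_range_succ', MvPolynomial.esymm_zero, map_one, one_mul, Nat.sub_zero] at h
  rw [h, Finset.sum_range, add_comm]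
  refine congrArg _ (Finset.sum_congr rfl fun k _ => ?_)
  rw [symmetrization, Nat.sub_sub, Nat.add_comm 1]

/-- The monic polynomial with coefficients `u` splits over `ℂ`; the negatives of its roots form a
preimage. -/
theorem symmetrization_surjective (n : ℕ) : Function.Surjective (symmetrization n) := by
  intro u
  let q : Polynomial ℂ := ∑ k : Fin n, Polynomial.C (u k) * Polynomial.X ^ (n - 1 - k : ℕ)
  have hq : q.degree < n := by
    refine Polynomial.mem_degreeLT.mp (Submodule.sum_mem _ fun k _ => ?_)
    refine Polynomial.mem_degreeLT.mpr ?_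
    refine (Polynomial.degree_C_mul_X_pow_le _ _).trans_lt ?_
    exact_mod_cast (by omega : n - 1 - (k : ℕ) < n)
  let p : Polynomial ℂ := Polynomial.X ^ n + q
  have hp : p.Monic := Polynomial.monic_X_pow_add hq
  have hs := IsAlgClosed.splits p
  have hcard : p.roots.toList.length = n := by
    rw [Multiset.length_toList, ← hs.natDegree_eq_card_roots]
    exact Polynomial.natDegree_eq_of_degree_eq_some
      ((Polynomial.degree_add_eq_left_of_degree_lt (by simpa using hq)).trans
        (Polynomial.degree_X_pow n))
  let z : Fin n → ℂ := fun i => -p.roots.toList.get (i.cast hcard.symm)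
  have hz : p = ∏ i, (Polynomial.X + Polynomial.C (z i)) := by
    have h1 := hs.eq_prod_roots_of_monic hp
    rw [← Multiset.coe_toList p.roots, Multiset.map_coe, Multiset.prod_coe] at h1
    rw [h1, ← Fin.prod_univ_getElem]
    refine Fintype.prod_equiv (finCongr (by rw [List.length_map, hcard])) _ _ fun i => ?_
    simp [z, sub_eq_add_neg]
  refine ⟨z, funext fun k => ?_⟩
  have h1 := congrArg (fun p => p.coeff (n - 1 - k)) hz
  simp only [Finset.prod_X_add_C_coeff Finset.univ z
    (by simp; omega : n - 1 - (k : ℕ) ≤ (Finset.univ : Finset (Fin n)).card)] at h1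
  have h2 : p.coeff (n - 1 - k) = u k := by
    simp only [p, q, Polynomial.coeff_add, Polynomial.finsetSum_coeff, Polynomial.coeff_X_pow,
      Polynomial.coeff_C_mul]
    rw [if_neg (by omega), zero_add, Finset.sum_eq_single k]
    · simp
    · intro j _ hj
      rw [if_neg, mul_zero]
      have := Fin.val_ne_of_ne hj
      omega
    · simp
  have hk : n - (n - 1 - (k : ℕ)) = k + 1 := by omega
  rw [← h2, h1, Finset.card_univ, Fintype.card_fin, hk]
  simp [symmetrization, MvPolynomial.esymm]

/-- The image of a polydisc of radius at most one under the symmetrization map is open. -/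
theorem isOpen_symmetrization_image {n : ℕ} {r : ℝ} (hr : r ≤ 1) :
    IsOpen (symmetrization n '' {z | ∀ j, ‖z j‖ < r}) := by
  rcases Nat.eq_zero_or_pos n with rfl | hn
  · exact isOpen_discrete _
  have : NeZero n := ⟨hn.ne'⟩
  rw [Metric.isOpen_iff]
  rintro _ ⟨a, ha, rfl⟩
  have hr0 : 0 < r := (norm_nonneg _).trans_lt (ha 0)
  obtain ⟨b, hb0, hbr, hab⟩ : ∃ b, 0 < b ∧ b < r ∧ ∀ j, ‖a j‖ ≤ b := by
    obtain ⟨i, hi⟩ := Finite.exists_max fun j => ‖a j‖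
    obtain ⟨b, hib, hbr⟩ := exists_between (ha i)
    exact ⟨b, (norm_nonneg _).trans_lt hib, hbr, fun j => (hi j).trans hib.le⟩
  -- Quantitative continuity of roots: if a nearby polynomial had a root `-z j` with `‖z j‖ ≥ r`,
  -- the bounds `h4` and `h5` would force the distance of the coefficients to be at least this
  -- radius.
  refine ⟨(r - b) ^ n / n, by have := sub_pos.mpr hbr; positivity, fun u hu => ?_⟩
  obtain ⟨z, rfl⟩ := symmetrization_surjective n u
  refine ⟨z, fun j => ?_, rfl⟩
  by_contra! hj
  have h1 := prod_add_eq a (-z j)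
  have h2 := prod_add_eq z (-z j)
  rw [Finset.prod_eq_zero (Finset.mem_univ j) (neg_add_cancel _)] at h2
  -- At `-z j` the polynomial of `z` vanishes and the leading terms cancel, so only differences of
  -- coefficients remain.
  have h3 : ∏ i, (-z j + a i) = ∑ k : Fin n,
      (symmetrization n a k - symmetrization n z k) * (-z j) ^ (n - 1 - k : ℕ) := by
    simp only [sub_mul, Finset.sum_sub_distrib]
    linear_combination h1 - h2
  have h4 : (‖z j‖ * ((r - b) / r)) ^ n ≤ ‖∏ i, (-z j + a i)‖ := by
    rw [norm_prod, ← Fin.prod_const]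
    refine Finset.prod_le_prod (fun _ _ => by positivity) fun i _ => ?_
    have h5 : ‖z j‖ - ‖a i‖ ≤ ‖-z j + a i‖ := by
      rw [← norm_neg (z j)]
      simpa using norm_sub_norm_le (-z j) (-a i)
    refine le_trans ?_ h5
    have h6 : b ≤ b * (‖z j‖ / r) :=
      le_mul_of_one_le_right hb0.le ((one_le_div hr0).mpr hj)
    have h7 : ‖z j‖ * ((r - b) / r) = ‖z j‖ - b * (‖z j‖ / r) := by
      field_simp
    linarith [hab i]
  -- Since `‖z j‖ / r ≥ 1` and `r ≤ 1`, every lower power of `‖z j‖` is at most `(‖z j‖ / r) ^ n`,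
  -- the factor that also appears in `h4` and cancels.
  have h5 : ∀ k : Fin n, ‖(symmetrization n a k - symmetrization n z k) * (-z j) ^ (n - 1 - k : ℕ)‖
      ≤ dist (symmetrization n z) (symmetrization n a) * (‖z j‖ / r) ^ n := by
    intro k
    rw [norm_mul, norm_pow, norm_neg, ← dist_eq_norm, dist_comm]
    refine mul_le_mul (dist_le_pi_dist _ _ k) ?_ (by positivity) dist_nonneg
    refine (pow_le_pow_left₀ (norm_nonneg _) (le_div_self (norm_nonneg _) hr0 hr) _).trans ?_
    exact pow_le_pow_right₀ ((one_le_div hr0).mpr hj) (by omega)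
  have h6 := h4.trans ((h3 ▸ norm_sum_le _ _).trans (Finset.sum_le_sum fun k _ => h5 k))
  rw [Finset.sum_const, Finset.card_univ, Fintype.card_fin, nsmul_eq_mul, mul_div_assoc',
    mul_comm ‖z j‖, mul_div_assoc, mul_pow, ← mul_assoc] at h6
  have h7 : 0 < (‖z j‖ / r) ^ n := by
    have := hr0.trans_le hj
    positivity
  have h8 := le_of_mul_le_mul_right h6 h7
  rw [Metric.mem_ball, lt_div_iff₀ (by positivity)] at hu
  linarith

/-! ### Antisymmetric polynomials -/

section Antisymmetric

open MvPolynomial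

variable {n : ℕ}

/-- The substitution of the variable `X j` for the variable `X i`. -/
def identify (i j : Fin n) : MvPolynomial (Fin n) ℂ →ₐ[ℂ] MvPolynomial (Fin n) ℂ :=
  aeval (Function.update X i (X j))

theorem dvd_sub_identify (i j : Fin n) (p : MvPolynomial (Fin n) ℂ) :
    X j - X i ∣ p - identify i j p := by
  rw [← Ideal.mem_span_singleton, ← Ideal.Quotient.mk_eq_mk_iff_sub_mem]
  have : (Ideal.Quotient.mkₐ ℂ (Ideal.span {X j - X i})).comp
      (AlgHom.id ℂ (MvPolynomial (Fin n) ℂ))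
      = (Ideal.Quotient.mkₐ ℂ (Ideal.span {X j - X i})).comp (identify i j) := by
    refine MvPolynomial.algHom_ext fun k => ?_
    rcases eq_or_ne k i with rfl | hk
    · simp only [identify, AlgHom.comp_apply, aeval_X, Function.update_self, AlgHom.id_apply,
        Ideal.Quotient.mkₐ_eq_mk]
      rw [Ideal.Quotient.mk_eq_mk_iff_sub_mem, Ideal.mem_span_singleton]
      exact ⟨-1, by ring⟩
    · simp [identify, hk]
  exact DFunLike.congr_fun this p

/-- Turns divisibility by `X j - X i` into membership in the kernel of a homomorphism to a domain,
which makes primality and coprimality of these factors easy to test. -/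
theorem dvd_iff_identify {i j : Fin n} (p : MvPolynomial (Fin n) ℂ) :
    X j - X i ∣ p ↔ identify i j p = 0 := by
  constructor
  · rintro ⟨q, rfl⟩
    rcases eq_or_ne j i with rfl | h <;> simp [identify, *]
  · intro h
    simpa [h] using dvd_sub_identify i j p

theorem prime_X_sub_X {i j : Fin n} (h : i ≠ j) :
    Prime (X j - X i : MvPolynomial (Fin n) ℂ) := by
  refine ⟨fun h0 => h ?_, fun hu => ?_, fun p q hpq => ?_⟩
  · exact (MvPolynomial.X_injective (sub_eq_zero.mp h0)).symm
  · have := (dvd_iff_identify (1 : MvPolynomial (Fin n) ℂ)).mp hu.dvd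
    simp at this
  · rw [dvd_iff_identify, map_mul, mul_eq_zero] at hpq
    rwa [dvd_iff_identify, dvd_iff_identify]

theorem isRelPrime_X_sub_X {i j k l : Fin n} (hij : i < j) (hkl : k < l)
    (h : (i, j) ≠ (k, l)) :
    IsRelPrime (X j - X i : MvPolynomial (Fin n) ℂ) (X l - X k) := by
  rw [(prime_X_sub_X hij.ne).irreducible.isRelPrime_iff_not_dvd, dvd_iff_identify]
  intro h0
  have h1 : (Function.update X i (X j) l : MvPolynomial (Fin n) ℂ)
      = Function.update X i (X j) k := by
    simpa [identify, sub_eq_zero] using h0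
  simp only [Function.update_apply] at h1
  -- Substituting `X j` for `X i` merges only the variables `i` and `j`; with both pairs increasing,
  -- this forces `(k, l) = (i, j)`.
  split_ifs at h1 <;> (have h2 := MvPolynomial.X_injective h1; simp_all; try omega)

variable (n) in
/-- The Vandermonde polynomial. -/
def vandermondePoly : MvPolynomial (Fin n) ℂ := (Matrix.vandermonde X).det

theorem vandermondePoly_ne_zero : vandermondePoly n ≠ 0 :=
  Matrix.det_vandermonde_ne_zero_iff.mpr MvPolynomial.X_injective

theorem rename_vandermondePoly (σ : Equiv.Perm (Fin n)) :
    rename σ (vandermondePoly n) = ((Equiv.Perm.sign σ : ℤ) : ℂ) • vandermondePoly n := by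
  rw [vandermondePoly, AlgHom.map_det]
  have : (rename σ : MvPolynomial (Fin n) ℂ →ₐ[ℂ] MvPolynomial (Fin n) ℂ).mapMatrix
      (Matrix.vandermonde X) = (Matrix.vandermonde X).submatrix σ id := by
    ext1 i j
    simp [Matrix.vandermonde_apply]
  rw [this, Matrix.det_permute, MvPolynomial.smul_eq_C_mul]
  simp

theorem eval_vandermondePoly_ne_zero {z : Fin n → ℂ} (hz : Function.Injective z) :
    eval z (vandermondePoly n) ≠ 0 := by
  rw [vandermondePoly, RingHom.map_det]
  have : (eval z).mapMatrix (Matrix.vandermonde X) = Matrix.vandermonde z := by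
    ext i j
    simp [Matrix.vandermonde_apply]
  rw [this]
  exact Matrix.det_vandermonde_ne_zero_iff.mpr hz

/-- An antisymmetric polynomial is the product of the Vandermonde polynomial and a symmetric
polynomial. -/
theorem exists_eq_vandermondePoly_mul {p : MvPolynomial (Fin n) ℂ}
    (hp : ∀ σ : Equiv.Perm (Fin n), rename σ p = ((Equiv.Perm.sign σ : ℤ) : ℂ) • p) :
    ∃ q : MvPolynomial (Fin n) ℂ, q.IsSymmetric ∧ p = vandermondePoly n * q := by
  have hdvd : ∀ i j : Fin n, i < j → X j - X i ∣ p := by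
    intro i j hij
    rw [dvd_iff_identify]
    -- Once the two variables are identified, swapping them has no effect; antisymmetry then makes
    -- the result equal to its own negative.
    have h1 : identify i j (rename (Equiv.swap i j) p) = identify i j p := by
      rw [identify, aeval_rename]
      congr 2
      ext1 k
      rcases eq_or_ne k i with rfl | hki
      · simp [hij.ne']
      rcases eq_or_ne k j with rfl | hkj
      · simp [hij.ne']
      · simp [Equiv.swap_apply_of_ne_of_ne hki hkj]
    rw [hp, Equiv.Perm.sign_swap hij.ne] at h1
    simp only [Units.val_neg, Units.val_one, Int.cast_neg, Int.cast_one, neg_smul, one_smul,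
      map_neg] at h1
    exact self_eq_neg.mp h1.symm
  have hd : vandermondePoly n ∣ p := by
    rw [vandermondePoly, Matrix.det_vandermonde, Finset.prod_sigma']
    -- The Vandermonde determinant is a product of pairwise coprime factors, each dividing `p`.
    refine Finset.prod_dvd_of_isRelPrime ?_ fun x hx => ?_
    · rintro ⟨i, j⟩ hij ⟨k, l⟩ hkl h
      simp only [Finset.coe_sigma, Set.mem_sigma_iff, Finset.mem_coe, Finset.mem_Ioi] at hij hkl
      exact isRelPrime_X_sub_X hij.2 hkl.2 (by simpa using h)
    · exact hdvd _ _ (by simpa using hx)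
  obtain ⟨q, hq⟩ := hd
  refine ⟨q, fun σ => ?_, hq⟩
  have h1 := hp σ
  rw [hq, map_mul, rename_vandermondePoly, ← smul_mul_assoc] at h1
  refine mul_left_cancel₀ (smul_ne_zero ?_ vandermondePoly_ne_zero) h1
  exact_mod_cast (Equiv.Perm.sign σ).ne_zero

end Antisymmetric

/-! ### Polynomials in the weighted Bergman space -/

section Polynomials

variable {n : ℕ} {lam : ℝ} [hl : Fact (0 < lam)]

/-- The centre of the polydisc. -/
def polydiscZero (n : ℕ) : Polydisc n := ⟨0, fun _ => by simp⟩

/-- Places the constant function 1 in the space, so that multiplication operators produce all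
polynomials from it. -/
theorem kerFun_polydiscZero_apply (z : Polydisc n) :
    RKHS.kerFun (BergmanSpace n lam) (polydiscZero n) (1 : ℂ) z = 1 := by
  rw [← inner_kerFun_one, inner_kerFun_kerFun]
  simp [bergmanKernel, polydiscZero]

variable (n lam) in
/-- A polynomial, as an element of the weighted Bergman space. -/
def ofPoly : MvPolynomial (Fin n) ℂ →ₗ[ℂ] BergmanSpace n lam where
  toFun p := mulOp n lam p (RKHS.kerFun (BergmanSpace n lam) (polydiscZero n) (1 : ℂ))
  map_add' p q := by ext z; simp [add_mul]
  map_smul' a p := by ext z; simp [mul_assoc]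

@[simp]
theorem ofPoly_apply (p : MvPolynomial (Fin n) ℂ) (z : Polydisc n) :
    ofPoly n lam p z = MvPolynomial.eval z.1 p := by
  change mulOp n lam p _ z = _
  rw [mulOp_apply, kerFun_polydiscZero_apply, mul_one]

/-- In the isometric model inside square summable families, the coordinates of `S f` are the
pairings of `f` with the normalized monomials, so a function orthogonal to all polynomials vanishes.
-/
theorem denseRange_ofPoly : DenseRange (ofPoly n lam) := by
  obtain ⟨S, hS⟩ := exists_isometry (H := BergmanSpace n lam) (feature n hl.out) (fun z w => by
    rw [inner_kerFun_kerFun, inner_feature])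
  have hmon : ∀ m : Fin n → ℕ, S.toContinuousLinearMap.adjoint (lp.single 2 m (1 : ℂ))
      = ofPoly n lam
        (∏ j, (MvPolynomial.C (Real.sqrt (coeff lam (m j)) : ℂ) * MvPolynomial.X j ^ m j)) := by
    intro m
    ext z
    rw [← inner_kerFun_one, ContinuousLinearMap.adjoint_inner_right, ofPoly_apply]
    simp only [LinearIsometry.coe_toContinuousLinearMap, hS]
    rw [lp.inner_single_right]
    simp [feature, featureFun]
  rw [DenseRange, ← LinearMap.coe_range, Submodule.dense_iff_topologicalClosure_eq_top,
    Submodule.topologicalClosure_eq_top_iff, Submodule.eq_bot_iff]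
  intro f hf
  refine S.injective (Eq.trans ?_ S.map_zero.symm)
  ext m
  have h1 := Submodule.inner_right_of_mem_orthogonal (LinearMap.mem_range_self (ofPoly n lam)
    (∏ j, (MvPolynomial.C (Real.sqrt (coeff lam (m j)) : ℂ) * MvPolynomial.X j ^ m j))) hf
  rw [← hmon, ContinuousLinearMap.adjoint_inner_left, lp.inner_single_left] at h1
  simpa using h1

theorem ofPoly_injective : Function.Injective (ofPoly n lam) := by
  intro p q h
  refine MvPolynomial.funext_set (fun _ => Metric.ball (0 : ℂ) 1)
    (fun _ => infinite_of_mem_nhds (0 : ℂ) (Metric.ball_mem_nhds 0 one_pos)) fun z hz => ?_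
  have := DFunLike.congr_fun h (⟨z, fun j => by simpa using hz j (Set.mem_univ j)⟩ : Polydisc n)
  simpa using this

theorem permOp_ofPoly (σ : Equiv.Perm (Fin n)) (p : MvPolynomial (Fin n) ℂ) :
    permOp n lam σ (ofPoly n lam p) = ofPoly n lam (MvPolynomial.rename σ p) := by
  ext z
  rw [permOp_apply, ofPoly_apply, ofPoly_apply, MvPolynomial.eval_rename]
  rfl

theorem ofPoly_mem_isotypicSubspace_iff (χ : Equiv.Perm (Fin n) →* ℂ)
    (p : MvPolynomial (Fin n) ℂ) :
    ofPoly n lam p ∈ isotypicSubspace n lam χ ↔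
      ∀ σ : Equiv.Perm (Fin n), MvPolynomial.rename σ p = χ σ • p := by
  rw [mem_isotypicSubspace_iff]
  refine forall_congr' fun σ => ?_
  rw [permOp_ofPoly, ← map_smul]
  exact ofPoly_injective.eq_iff

theorem isotypicProj_ofPoly (χ : Equiv.Perm (Fin n) → ℂ) (p : MvPolynomial (Fin n) ℂ) :
    ∃ q, isotypicProj n lam χ (ofPoly n lam p) = ofPoly n lam q := by
  refine ⟨(χ 1 / (n.factorial : ℂ)) •
    ∑ σ : Equiv.Perm (Fin n), conj (χ σ) • MvPolynomial.rename σ p, ?_⟩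
  simp [isotypicProj, permOp_ofPoly]

end Polynomials

/-! ### Estimates on tori -/

/-- The maximum principle on a closed polydisc, for polynomials. -/
theorem norm_eval_le_of_torus {n : ℕ} (q : MvPolynomial (Fin n) ℂ) {R : Fin n → ℝ}
    (hR : ∀ j, 0 < R j) {M : ℝ}
    (hM : ∀ z : Fin n → ℂ, (∀ j, ‖z j‖ = R j) → ‖MvPolynomial.eval z q‖ ≤ M) {a : Fin n → ℂ}
    (ha : ∀ j, ‖a j‖ ≤ R j) : ‖MvPolynomial.eval a q‖ ≤ M := by
  -- Here `s` collects the coordinates allowed inside their discs; each is pushed to its circle by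
  -- the one-variable maximum principle.
  have key : ∀ s : Finset (Fin n), ∀ z : Fin n → ℂ, (∀ j ∈ s, ‖z j‖ ≤ R j) →
      (∀ j ∉ s, ‖z j‖ = R j) → ‖MvPolynomial.eval z q‖ ≤ M := by
    intro s
    induction s using Finset.induction_on with
    | empty => exact fun z _ hz => hM z fun j => hz j (Finset.notMem_empty j)
    | insert i s hi ih =>
      intro z hz hz'
      have hd : Differentiable ℂ fun t => MvPolynomial.eval (Function.update z i t) q :=
        (differentiable_eval q).comp (differentiable_pi.mpr fun j => by
          rcases eq_or_ne j i with rfl | hj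
          · simp
          · simp [hj])
      have h1 := Complex.norm_le_of_forall_mem_frontier_norm_le (U := Metric.ball (0 : ℂ) (R i))
        Metric.isBounded_ball hd.diffContOnCl (C := M) (fun t ht => ?_) (z := z i) ?_
      · simpa using h1
      · rw [frontier_ball _ (hR i).ne', mem_sphere_zero_iff_norm] at ht
        refine ih _ (fun j hj => ?_) fun j hj => ?_
        · rw [Function.update_of_ne (ne_of_mem_of_not_mem hj hi)]
          exact hz j (Finset.mem_insert_of_mem hj)
        · rcases eq_or_ne j i with rfl | hji
          · simpa using ht
          · rw [Function.update_of_ne hji]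
            exact hz' j (by simp [hji, hj])
      · rw [closure_ball _ (hR i).ne', mem_closedBall_zero_iff]
        exact hz i (Finset.mem_insert_self i s)
  exact key Finset.univ a (fun j _ => ha j) fun j hj => absurd (Finset.mem_univ j) hj

/-- A polynomial without zeros on a torus is bounded below there. -/
theorem exists_le_norm_eval_of_torus {n : ℕ} (p : MvPolynomial (Fin n) ℂ) {R : Fin n → ℝ}
    (hp : ∀ z : Fin n → ℂ, (∀ j, ‖z j‖ = R j) → MvPolynomial.eval z p ≠ 0) :
    ∃ c > 0, ∀ z : Fin n → ℂ, (∀ j, ‖z j‖ = R j) → c ≤ ‖MvPolynomial.eval z p‖ := by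
  have hK : IsCompact (Set.univ.pi fun j => Metric.sphere (0 : ℂ) (R j)) :=
    isCompact_univ_pi fun j => isCompact_sphere 0 (R j)
  obtain ⟨c, hc, h⟩ := hK.exists_forall_le' (f := fun z => ‖MvPolynomial.eval z p‖)
    (differentiable_eval p).continuous.norm.continuousOn (a := 0) (fun z hz => by
      simpa using hp z fun j => by simpa using hz j (Set.mem_univ j))
  exact ⟨c, hc, fun z hz => h z fun j _ => by simpa using hz j⟩

/-- On a torus, the values of a function in the weighted Bergman space are bounded by a multiple of
its norm. -/
theorem exists_norm_apply_le_of_torus (n : ℕ) (lam : ℝ) [Fact (0 < lam)] (R : Fin n → ℝ) :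
    ∃ M, ∀ (f : BergmanSpace n lam) (z : Polydisc n), (∀ j, ‖z.1 j‖ = R j) →
      ‖f z‖ ≤ M * ‖f‖ := by
  -- On the diagonal the kernel depends only on the moduli of the coordinates, so one constant
  -- serves the whole torus.
  refine ⟨Real.sqrt ‖∏ j, (1 - (R j : ℂ) ^ 2) ^ (-(lam : ℂ))‖, fun f z hz => ?_⟩
  have h1 : ⟪RKHS.kerFun (BergmanSpace n lam) z (1 : ℂ),
      RKHS.kerFun (BergmanSpace n lam) z (1 : ℂ)⟫_ℂ = ∏ j, (1 - (R j : ℂ) ^ 2) ^ (-(lam : ℂ)) := by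
    rw [inner_kerFun_kerFun, bergmanKernel]
    simp only [Complex.mul_conj', hz]
  rw [inner_self_eq_norm_sq_to_K] at h1
  rw [← h1, norm_pow, Real.sqrt_sq (norm_nonneg _), ← inner_kerFun_one]
  simpa using norm_inner_le_norm (𝕜 := ℂ) (RKHS.kerFun (BergmanSpace n lam) z (1 : ℂ)) f

/-! ### Local freeness -/

section LocallyFree

theorem eval_esymmAlgHom {n : ℕ} (p : MvPolynomial (Fin n) ℂ) (z : Fin n → ℂ) :
    MvPolynomial.eval z (MvPolynomial.esymmAlgHom (Fin n) ℂ n p).1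
      = MvPolynomial.eval (symmetrization n z) p := by
  rw [MvPolynomial.esymmAlgHom_apply, ← MvPolynomial.aeval_eq_eval, ← AlgHom.comp_apply,
    MvPolynomial.comp_aeval]
  rfl

/-- A polynomial which generates the polynomials transforming by the character `χ` over the
symmetric polynomials, and does not vanish at points with distinct coordinates. -/
structure IsGenerator {n : ℕ} (χ : Equiv.Perm (Fin n) →* ℂ) (D : MvPolynomial (Fin n) ℂ) :
    Prop where
  rename_eq : ∀ σ : Equiv.Perm (Fin n), MvPolynomial.rename σ D = χ σ • D
  exists_eq_mul : ∀ p : MvPolynomial (Fin n) ℂ,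
    (∀ σ : Equiv.Perm (Fin n), MvPolynomial.rename σ p = χ σ • p) →
      ∃ q : MvPolynomial (Fin n) ℂ, q.IsSymmetric ∧ p = D * q
  eval_ne_zero : ∀ z : Fin n → ℂ, Function.Injective z → MvPolynomial.eval z D ≠ 0

theorem isGenerator_trivialChar (n : ℕ) : IsGenerator (trivialChar n) 1 where
  rename_eq σ := by simp [trivialChar]
  exists_eq_mul p hp := ⟨p, fun σ => by simpa [trivialChar] using hp σ, (one_mul p).symm⟩
  eval_ne_zero z _ := by simp

theorem isGenerator_signChar (n : ℕ) : IsGenerator (signChar n) (vandermondePoly n) where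
  rename_eq σ := rename_vandermondePoly σ
  exists_eq_mul _ hp := exists_eq_vandermondePoly_mul hp
  eval_ne_zero _ hz := eval_vandermondePoly_ne_zero hz

variable {n : ℕ} {lam : ℝ} [hl : Fact (0 < lam)] {χ : Equiv.Perm (Fin n) →* ℂ}
  {D : MvPolynomial (Fin n) ℂ}

theorem isotypicProj_of_mem {f : BergmanSpace n lam} (hf : f ∈ isotypicSubspace n lam χ) :
    isotypicProj n lam χ f = f := by
  have hχ : ∀ σ, conj (χ σ) * χ σ = 1 := fun σ => by
    have h1 : ‖χ σ‖ = 1 := Complex.norm_eq_one_of_pow_eq_one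
      (by rw [← map_pow, pow_orderOf_eq_one, map_one]) (orderOf_pos σ).ne'
    rw [mul_comm, Complex.mul_conj, Complex.normSq_eq_norm_sq, h1]
    simp
  have h := (mem_isotypicSubspace_iff χ f).mp hf
  simp only [isotypicProj, smul_apply, sum_apply, h, smul_smul, hχ, one_smul, map_one]
  rw [Finset.sum_const, Finset.card_univ, Fintype.card_perm, Fintype.card_fin,
    ← Nat.cast_smul_eq_nsmul ℂ, smul_smul, one_div, inv_mul_cancel₀, one_smul]
  exact_mod_cast n.factorial_ne_zero

namespace IsGenerator

/-- The generator, as an element of the submodule of the weighted Bergman space. -/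
def vector (hD : IsGenerator χ D) : isotypicSubspace n lam χ :=
  ⟨ofPoly n lam D, (ofPoly_mem_isotypicSubspace_iff χ D).mpr hD.rename_eq⟩

theorem coe_smul_vector (hD : IsGenerator χ D) (p : MvPolynomial (Fin n) ℂ) :
    ((HilbertModule.ofSymmetric (isotypicModule n lam χ) p hD.vector :
      isotypicSubspace n lam χ) : BergmanSpace n lam)
      = ofPoly n lam (D * (MvPolynomial.esymmAlgHom (Fin n) ℂ n p).1) := by
  change mulOp n lam (MvPolynomial.esymmAlgHom (Fin n) ℂ n p).1 (ofPoly n lam D) = _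
  ext z
  simp [mul_comm]

theorem denseRange_smul_vector (hD : IsGenerator χ D) :
    DenseRange fun p => HilbertModule.ofSymmetric (isotypicModule n lam χ) p hD.vector := by
  let T : BergmanSpace n lam →L[ℂ] isotypicSubspace n lam χ :=
    (isotypicProj n lam χ).codRestrict _ fun f => LinearMap.mem_range_self _ f
  have hT : Function.Surjective T := fun f => ⟨f, Subtype.ext (isotypicProj_of_mem f.2)⟩
  -- The projection carries the dense set of polynomials to a dense set of polynomials of the right
  -- symmetry type, each a multiple of `D`.
  refine (hT.denseRange.comp denseRange_ofPoly T.continuous).mono ?_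
  rintro _ ⟨p, rfl⟩
  obtain ⟨q, hq⟩ := isotypicProj_ofPoly (lam := lam) χ p
  have hmem : ofPoly n lam q ∈ isotypicSubspace n lam χ := hq ▸ LinearMap.mem_range_self _ _
  obtain ⟨t, ht, rfl⟩ := hD.exists_eq_mul q ((ofPoly_mem_isotypicSubspace_iff χ q).mp hmem)
  obtain ⟨s, hs⟩ := MvPolynomial.esymmAlgHom_surjective ℂ (Fintype.card_fin n).le
    ⟨t, ht⟩
  refine ⟨s, Subtype.ext ?_⟩
  rw [coe_smul_vector, hs]
  exact hq.symm

theorem exists_norm_eval_le (hD : IsGenerator χ D) {r : ℝ} (hr0 : 0 < r) (hr : r < 1) :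
    ∃ C, ∀ u ∈ symmetrization n '' {z | ∀ j, ‖z j‖ < r}, ∀ p, ‖MvPolynomial.eval u p‖
      ≤ C * ‖HilbertModule.ofSymmetric (isotypicModule n lam χ) p hD.vector‖ := by
  -- Any pairwise distinct radii in `[r, 1)` would do; distinctness keeps the torus away from the
  -- zeros of `D`.
  let R : Fin n → ℝ := fun j => 1 - (1 - r) / (j + 2)
  have hRinj : Function.Injective R := by
    intro i j hij
    have h1 : (1 - r) / ((i : ℝ) + 2) = (1 - r) / ((j : ℝ) + 2) := by simpa [R] using hij
    have h2 : (1 - r) ≠ 0 := by linarith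
    field_simp at h1
    exact Fin.ext (by exact_mod_cast (by linarith : (i : ℝ) = j))
  have hRr : ∀ j, r ≤ R j := fun j => by
    have : (1 - r) / ((j : ℝ) + 2) ≤ 1 - r :=
      div_le_self (by linarith) (by linarith [(Nat.cast_nonneg j : (0 : ℝ) ≤ (j : ℕ))])
    simp only [R]
    linarith
  have hR1 : ∀ j, R j < 1 := fun j => by
    have : 0 < (1 - r) / ((j : ℝ) + 2) := div_pos (by linarith) (by positivity)
    simp only [R]
    linarith
  obtain ⟨c, hc, hcD⟩ := exists_le_norm_eval_of_torus D (R := R) fun z hz =>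
    hD.eval_ne_zero z fun i j hij => hRinj (by rw [← hz i, ← hz j, hij])
  obtain ⟨M, hM⟩ := exists_norm_apply_le_of_torus n lam R
  refine ⟨M / c, ?_⟩
  rintro _ ⟨a, ha, rfl⟩ p
  rw [← eval_esymmAlgHom]
  refine norm_eval_le_of_torus _ (fun j => hr0.trans_le (hRr j)) (fun z hz => ?_)
    fun j => ((ha j).le.trans (hRr j))
  have h1 := hM (ofPoly n lam (D * (MvPolynomial.esymmAlgHom (Fin n) ℂ n p).1))
    ⟨z, fun j => (hz j).trans_lt (hR1 j)⟩ hz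
  rw [ofPoly_apply, map_mul, norm_mul, ← coe_smul_vector hD, ← Submodule.coe_norm] at h1
  rw [div_mul_eq_mul_div, le_div_iff₀ hc, mul_comm]
  exact (mul_le_mul_of_nonneg_right (hcD z hz) (norm_nonneg _)).trans h1

theorem isLocallyFreeOn (hD : IsGenerator χ D) :
    HilbertModule.IsLocallyFreeOn (HilbertModule.ofSymmetric (isotypicModule n lam χ))
      (symmetrizedPolydisc n) 1 := by
  rintro w ⟨a, ha, haw⟩
  -- A slightly smaller polydisc still contains `a`; its image is the neighbourhood with a uniform
  -- bound.
  obtain ⟨r, hr0, hr1, har⟩ : ∃ r, 0 < r ∧ r < 1 ∧ ∀ j, ‖a j‖ < r := by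
    rcases isEmpty_or_nonempty (Fin n) with h | h
    · exact ⟨1 / 2, by norm_num, by norm_num, fun j => h.elim j⟩
    · obtain ⟨i, hi⟩ := Finite.exists_max fun j => ‖a j‖
      obtain ⟨r, hir, hr⟩ := exists_between (ha i)
      exact ⟨r, (norm_nonneg _).trans_lt hir, hr, fun j => (hi j).trans_lt hir⟩
  obtain ⟨C, hC⟩ := hD.exists_norm_eval_le (lam := lam) hr0 hr1
  refine HilbertModule.isLocallyFreeAt_of_cyclic _ hD.denseRange_smul_vector
    (isOpen_symmetrization_image hr1.le) ?_ hC ⟨a, har, haw⟩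
  exact Set.image_mono fun z hz j => (hz j).trans hr1

end IsGenerator

end LocallyFree

end SymPolydisc

end

theorem mainTheorem10 (n : ℕ) (hn : 1 ≤ n) (lam : ℝ) [hlam : Fact (0 < lam)] :
    SymPolydisc.HilbertModule.IsLocallyFreeOn
        (SymPolydisc.HilbertModule.ofSymmetric
          (SymPolydisc.isotypicModule n lam (SymPolydisc.trivialChar n)))
        (SymPolydisc.symmetrizedPolydisc n) 1 ∧
      SymPolydisc.HilbertModule.IsLocallyFreeOn
        (SymPolydisc.HilbertModule.ofSymmetric
          (SymPolydisc.isotypicModule n lam (SymPolydisc.signChar n)))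
        (SymPolydisc.symmetrizedPolydisc n) 1 :=
  ⟨(SymPolydisc.isGenerator_trivialChar n).isLocallyFreeOn,
    (SymPolydisc.isGenerator_signChar n).isLocallyFreeOn⟩
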